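/- Let $A,B,C,D,E,F$ be six parties and let $O$ be a purifier. A vector $S=(S_I)$ of six-party entropy space $\mathbb R^{63}$ has one component for every non-empty $I\subseteq\{A,\dots,F\}$; the components are ordered by $|I|$ and lexicographically within each size. Extend $S$ to subsets of $\{A,\dots,F,O\}$ by $S_\varnothing=0$ and $S_{I}=S_{I^c}$ when $O\in I$ (complement in $\{A,\dots,F,O\}$). The $6$-party subadditivity cone is the set of all $S$ with $S_I+S_K-S_{I\cup K}\ge 0$ for all disjoint $I,K\subseteq\{A,\dots,F,O\}$. A six-party hypergraph model is a finite vertex set $V$ with finitely many (hyper)edges, each a set of at least two vertices and carrying a positive weight, together with a set $\partial V\subseteq V$ of boundary vertices and a surjective map $\xi:\partial V\to\{A,\dots,F,O\}$. Its entropy vector has as its component $S_I$ the minimum, over all $W\subseteq V$ with $W\cap\partial V=\xi^{-1}(I)$, of the total weight of the (hyper)edges that have a vertex in $W$ and a vertex outside $W$. A graph model is a hypergraph model in which every edge has exactly two vertices. Theorem. Let $$\begin{aligned}R_6=(&2,1,1,1,2,2;\ 3,3,3,4,4,2,2,3,3,2,3,3,3,3,4;\\&2,4,5,5,4,5,5,3,5,4,3,4,4,4,4,5,4,4,5,3;\\&3,4,4,4,4,3,4,4,3,3,3,5,4,4,4;\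 3,3,2,2,2,3;\ 1).\end{aligned}$$ Then: 1. $R_6$ generates an extreme ray (a one-dimensional face) of the $6$-party subadditivity cone. 2. $R_6$ is the entropy vector of a quantum state: there are finite-dimensional Hilbert spaces $\mathcal H_A,\dots,\mathcal H_F$ and a density matrix $\rho$ on $\mathcal H_A\otimes\dots\otimes\mathcal H_F$ such that, for every non-empty $I\subseteq\{A,\dots,F\}$, the reduced state $\rho_I$ has von Neumann entropy $-\operatorname{tr}(\rho_I\log_2\rho_I)$ equal to the component $(R_6)_I$. 3. $R_6$ is the entropy vector of the hypergraph model with one boundary vertex for each of $A,\dots,F,O$, three further (bulk) vertices $u,v,w$, a hyperedge $\{A,u,v,w\}$ of weight $2$, an edge $\{v,E\}$ of weight $2$, and edges $\{u,B\},\{u,C\},\{v,D\},\{v,F\},\{w,F\},\{w,O\}$ of weight $1$. 4. $R_6$ is not the entropy vector of any graph model. In particular, not every extreme ray of the $6$-party subadditivity cone that is realized by a quantum state is realized by a graph model. -/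

import Mathlib

open scoped ComplexOrder

/-! ### Entropy vectors, subadditivity cone, extreme rays -/

/-- Entropy space for `N` parties: one real component for every non-empty set of parties,
so the dimension is `2 ^ N - 1`. -/
abbrev EntropyVec (N : ℕ) : Type := {I : Finset (Fin N) // I.Nonempty} → ℝ

/-- The purifier is the last element of `Fin (N + 1)`, and the parties are the others.
A subsystem that contains the purifier is replaced by its complement, so that the result is a
set of parties having the same entropy in a pure state of parties and purifier. -/
def dropPurifier {N : ℕ} (I : Finset (Fin (N + 1))) : Finset (Fin N) :=
  Finset.univ.filter fun i => i.castSucc ∈ (if Fin.last N ∈ I then Iᶜ else I)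

/-- The entropy that the vector `S` assigns to a subsystem which may include the purifier;
the entropy of the empty subsystem (and hence of everything) is `0`. -/
def EntropyVec.ent {N : ℕ} (S : EntropyVec N) (I : Finset (Fin (N + 1))) : ℝ :=
  if h : (dropPurifier I).Nonempty then S ⟨dropPurifier I, h⟩ else 0

theorem EntropyVec.ent_add {N : ℕ} (S T : EntropyVec N) (I : Finset (Fin (N + 1))) :
    EntropyVec.ent (S + T) I = EntropyVec.ent S I + EntropyVec.ent T I := by
  unfold EntropyVec.ent
  split_ifs <;> simp

theorem EntropyVec.ent_smul {N : ℕ} (c : ℝ) (S : EntropyVec N) (I : Finset (Fin (N + 1))) :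
    EntropyVec.ent (c • S) I = c * EntropyVec.ent S I := by
  unfold EntropyVec.ent
  split_ifs <;> simp

/-- The mutual information `S_I + S_K - S_{IK}` of two subsystems. -/
def EntropyVec.mutualInfo {N : ℕ} (S : EntropyVec N) (I K : Finset (Fin (N + 1))) : ℝ :=
  EntropyVec.ent S I + EntropyVec.ent S K - EntropyVec.ent S (I ∪ K)

/-- The `N`-party subadditivity cone: all instances of subadditivity for disjoint subsystems
of the `N` parties and the purifier. -/
def subadditivityCone (N : ℕ) : PointedCone ℝ (EntropyVec N) where
  carrier := {S | ∀ I K : Finset (Fin (N + 1)), Disjoint I K → 0 ≤ EntropyVec.mutualInfo S I K}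
  add_mem' := by
    intro S T hS hT I K hIK
    have h1 := hS I K hIK
    have h2 := hT I K hIK
    simp only [EntropyVec.mutualInfo, EntropyVec.ent_add] at *
    linarith
  zero_mem' := by
    intro I K _
    simp [EntropyVec.mutualInfo, EntropyVec.ent]
  smul_mem' := by
    intro c S hS I K hIK
    have h1 := mul_nonneg c.2 (hS I K hIK)
    have h2 : c • S = (c : ℝ) • S := rfl
    simp only [EntropyVec.mutualInfo, h2, EntropyVec.ent_smul] at *
    linarith

/-- The vector `v` generates an extreme ray of the cone `C`: it is non-zero, and the ray
`{t • v | 0 ≤ t}` is a face of `C`. -/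
def GeneratesExtremeRay {E : Type*} [AddCommGroup E] [Module ℝ E]
    (C : PointedCone ℝ E) (v : E) : Prop :=
  v ≠ 0 ∧ (PointedCone.hull ℝ {v}).IsFaceOf C

/-! ### Quantum states and von Neumann entropy -/

/-- Density matrices on the Hilbert space with orthonormal basis `n`. -/
structure DensityMatrix (n : Type*) [Fintype n] where
  mat : Matrix n n ℂ
  posSemidef : mat.PosSemidef
  trace_eq_one : mat.trace = 1

/-- Von Neumann entropy `- tr (ρ log₂ ρ)`, in bits. -/
noncomputable def DensityMatrix.entropy {n : Type*} [Fintype n] [DecidableEq n]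
    (ρ : DensityMatrix n) : ℝ :=
  (∑ k, Real.negMulLog (ρ.posSemidef.isHermitian.eigenvalues k)) / Real.log 2

/-- Combine a basis label of the subsystem `I` with one of the complementary subsystem. -/
def joinLabels {N : ℕ} {d : Fin N → ℕ} (I : Finset (Fin N))
    (a : (i : {i // i ∈ I}) → Fin (d i)) (c : (i : {i // i ∉ I}) → Fin (d i)) :
    (i : Fin N) → Fin (d i) :=
  fun i => if h : i ∈ I then a ⟨i, h⟩ else c ⟨i, h⟩

/-- Partial trace over the complement of `I`. Party `i` has the Hilbert space `ℂ ^ (d i)`, and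
the tensor product of these spaces has the basis `(i : Fin N) → Fin (d i)`. -/
def partialTrace {N : ℕ} {d : Fin N → ℕ} (I : Finset (Fin N))
    (M : Matrix ((i : Fin N) → Fin (d i)) ((i : Fin N) → Fin (d i)) ℂ) :
    Matrix ((i : {i // i ∈ I}) → Fin (d i)) ((i : {i // i ∈ I}) → Fin (d i)) ℂ :=
  Matrix.of fun a b => ∑ c, M (joinLabels I a c) (joinLabels I b c)

theorem partialTrace_posSemidef {N : ℕ} {d : Fin N → ℕ} (I : Finset (Fin N))
    {M : Matrix ((i : Fin N) → Fin (d i)) ((i : Fin N) → Fin (d i)) ℂ} (hM : M.PosSemidef) :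
    (partialTrace I M).PosSemidef := by
  have h : partialTrace I M =
      ∑ c, M.submatrix (fun a => joinLabels I a c) (fun a => joinLabels I a c) := by
    ext a b
    simp [partialTrace, Matrix.sum_apply]
  rw [h]
  exact Matrix.posSemidef_sum _ fun c _ => hM.submatrix _

theorem partialTrace_trace {N : ℕ} {d : Fin N → ℕ} (I : Finset (Fin N))
    (M : Matrix ((i : Fin N) → Fin (d i)) ((i : Fin N) → Fin (d i)) ℂ) :
    (partialTrace I M).trace = M.trace := by
  simp only [Matrix.trace, Matrix.diag_apply, partialTrace, Matrix.of_apply]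
  rw [← Fintype.sum_prod_type' (f := fun a c => M (joinLabels I a c) (joinLabels I a c))]
  exact Fintype.sum_equiv
    (Equiv.piEquivPiSubtypeProd (fun i => i ∈ I) (fun i => Fin (d i))).symm
    (fun x => M (joinLabels I x.1 x.2) (joinLabels I x.1 x.2)) (fun y => M y y) fun x => rfl

/-- The reduced state of the subsystem `I`. -/
def DensityMatrix.reduce {N : ℕ} {d : Fin N → ℕ} (ρ : DensityMatrix ((i : Fin N) → Fin (d i)))
    (I : Finset (Fin N)) : DensityMatrix ((i : {i // i ∈ I}) → Fin (d i)) where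
  mat := partialTrace I ρ.mat
  posSemidef := partialTrace_posSemidef I ρ.posSemidef
  trace_eq_one := (partialTrace_trace I ρ.mat).trans ρ.trace_eq_one

/-- The entropy vector of an `N`-party quantum state. -/
noncomputable def DensityMatrix.entropyVec {N : ℕ} {d : Fin N → ℕ}
    (ρ : DensityMatrix ((i : Fin N) → Fin (d i))) : EntropyVec N :=
  fun I => (ρ.reduce I.1).entropy

/-! ### Graph and hypergraph models -/

/-- An `N`-party hypergraph model on the vertex set `V`: finitely many (hyper)edges with positive
weights, and a surjective labelling of the boundary vertices by the `N` parties and the purifier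
(the last element of `Fin (N + 1)`). -/
structure HypergraphModel (N : ℕ) (V : Type*) [Fintype V] [DecidableEq V] where
  edges : Finset (Finset V)
  two_le_card : ∀ e ∈ edges, 2 ≤ e.card
  weight : Finset V → ℝ
  weight_pos : ∀ e ∈ edges, 0 < weight e
  boundary : Finset V
  label : {v // v ∈ boundary} → Fin (N + 1)
  label_surjective : Function.Surjective label

namespace HypergraphModel

variable {N : ℕ} {V : Type*} [Fintype V] [DecidableEq V]

/-- A graph model is a hypergraph model all of whose edges join exactly two vertices. -/
def IsGraph (G : HypergraphModel N V) : Prop := ∀ e ∈ G.edges, e.card = 2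

/-- `W` is a cut homologous to the set of parties `I`. -/
def IsCut (G : HypergraphModel N V) (I : Finset (Fin N)) (W : Finset V) : Prop :=
  ∀ v : {v // v ∈ G.boundary}, v.1 ∈ W ↔ ∃ i ∈ I, G.label v = i.castSucc

instance (G : HypergraphModel N V) (I : Finset (Fin N)) (W : Finset V) :
    Decidable (G.IsCut I W) := by
  unfold IsCut
  infer_instance

/-- Total weight of the (hyper)edges that have a vertex in `W` and a vertex outside `W`. -/
def cost (G : HypergraphModel N V) (W : Finset V) : ℝ :=
  ∑ e ∈ G.edges.filter (fun e => (∃ v ∈ e, v ∈ W) ∧ ∃ v ∈ e, v ∉ W), G.weight e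

theorem cuts_nonempty (G : HypergraphModel N V) (I : Finset (Fin N)) :
    (Finset.univ.filter fun W : Finset V => G.IsCut I W).Nonempty := by
  refine ⟨Finset.univ.filter fun v =>
    ∃ h : v ∈ G.boundary, ∃ i ∈ I, G.label ⟨v, h⟩ = i.castSucc, ?_⟩
  refine Finset.mem_filter.mpr ⟨Finset.mem_univ _, fun v => ?_⟩
  simp only [Finset.mem_filter, Finset.mem_univ, true_and]
  exact ⟨fun ⟨_, h⟩ => h, fun h => ⟨v.2, h⟩⟩

/-- The entropy vector of the model: the minimal cost of a cut homologous to `I`. -/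
noncomputable def entropyVec (G : HypergraphModel N V) : EntropyVec N := fun I =>
  (Finset.univ.filter fun W : Finset V => G.IsCut I.1 W).inf' (G.cuts_nonempty I.1) G.cost

end HypergraphModel

/-- The vector is the entropy vector of some graph model (its finite vertex set being named
`Fin n` without loss of generality). -/
def RealizedByGraphModel {N : ℕ} (S : EntropyVec N) : Prop :=
  ∃ (n : ℕ) (G : HypergraphModel N (Fin n)), G.IsGraph ∧ G.entropyVec = S

/-! ### The explicit vector and the explicit hypergraph -/

namespace SixParty

/-- The party `A`. -/
abbrev A : Fin 6 := 0
/-- The party `B`. -/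
abbrev B : Fin 6 := 1
/-- The party `C`. -/
abbrev C : Fin 6 := 2
/-- The party `D`. -/
abbrev D : Fin 6 := 3
/-- The party `E`. -/
abbrev E : Fin 6 := 4
/-- The party `F`. -/
abbrev F : Fin 6 := 5

/-- The components of the vector, by increasing size of the set of parties and
lexicographically among sets of equal size. -/
def rayTable : List (Finset (Fin 6) × ℕ) :=
   [({A}, 2), ({B}, 1), ({C}, 1), ({D}, 1), ({E}, 2), ({F}, 2),
    ({A, B}, 3), ({A, C}, 3), ({A, D}, 3), ({A, E}, 4), ({A, F}, 4), ({B, C}, 2),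
    ({B, D}, 2), ({B, E}, 3), ({B, F}, 3), ({C, D}, 2), ({C, E}, 3), ({C, F}, 3),
    ({D, E}, 3), ({D, F}, 3), ({E, F}, 4),
    ({A, B, C}, 2), ({A, B, D}, 4), ({A, B, E}, 5), ({A, B, F}, 5), ({A, C, D}, 4),
    ({A, C, E}, 5), ({A, C, F}, 5), ({A, D, E}, 3), ({A, D, F}, 5), ({A, E, F}, 4),
    ({B, C, D}, 3), ({B, C, E}, 4), ({B, C, F}, 4), ({B, D, E}, 4), ({B, D, F}, 4),
    ({B, E, F}, 5), ({C, D, E}, 4), ({C, D, F}, 4), ({C, E, F}, 5), ({D, E, F}, 3),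
    ({A, B, C, D}, 3), ({A, B, C, E}, 4), ({A, B, C, F}, 4), ({A, B, D, E}, 4),
    ({A, B, D, F}, 4), ({A, B, E, F}, 3), ({A, C, D, E}, 4), ({A, C, D, F}, 4),
    ({A, C, E, F}, 3), ({A, D, E, F}, 3), ({B, C, D, E}, 3), ({B, C, D, F}, 5),
    ({B, C, E, F}, 4), ({B, D, E, F}, 4), ({C, D, E, F}, 4),
    ({A, B, C, D, E}, 3), ({A, B, C, D, F}, 3), ({A, B, C, E, F}, 2), ({A, B, D, E, F}, 2),
    ({A, C, D, E, F}, 2), ({B, C, D, E, F}, 3),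
    ({A, B, C, D, E, F}, 1)]

/-- The vector `R₆` of six-party entropy space. -/
def ray : EntropyVec 6 := fun I => (((rayTable.lookup I.1).getD 0 : ℕ) : ℝ)

/-- A hypergraph model with boundary vertices `0, …, 5` (the parties `A, …, F`) and `6` (the
purifier `O`), and bulk vertices `7, 8, 9`. -/
noncomputable def hypergraph : HypergraphModel 6 (Fin 10) where
  edges := {{0, 7, 8, 9}, {7, 1}, {7, 2}, {8, 3}, {8, 4}, {8, 5}, {9, 5}, {9, 6}}
  two_le_card := by
    intro e he
    simp only [Finset.mem_insert, Finset.mem_singleton] at he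
    rcases he with rfl | rfl | rfl | rfl | rfl | rfl | rfl | rfl <;> decide
  weight e := if e = {0, 7, 8, 9} ∨ e = {8, 4} then 2 else 1
  weight_pos := by
    intro e _
    split_ifs <;> norm_num
  boundary := Finset.univ.filter fun v => v.1 < 7
  label v := ⟨v.1.1, (Finset.mem_filter.mp v.2).2⟩
  label_surjective := by
    intro j
    exact ⟨⟨⟨j.1, by omega⟩, by simp⟩, rfl⟩

end SixParty

/-! Graph models obey monogamy of mutual information (MMI), by a check on each edge separately
(`IsGraph.cost_mmi`). `R₆` violates it for `A`, `BC`, `DE`: the sum `2 + 2 + 3 + 3` should be at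
most `2 + 3 + 3`. So no graph realizes `R₆`. The edgewise check fails for a hyperedge with four
vertices, which is why the weight-2 hyperedge helps.

The hypergraph has three bulk vertices, so each entropy is a minimum over eight cuts, and all of
them are computed (`isLeast_cutCost`). Since unions of cuts are subadditive, this also puts `R₆` in
the subadditivity cone.

For extremality, if `a • x + y` lies on the ray, with `x`, `y` in the cone and `a > 0`, then `x`
saturates every instance of subadditivity saturated by `R₆`. These linear equations have a
one-dimensional solution space (`ent_eq_of_tight`), so `x` is a multiple of `R₆`.

The quantum state is a ten-qubit graph state with the purifier's qubit traced out. Its reductions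
are proportional to projections, and the entropy of `I` is the rank over the field with two elements
of the adjacency block between the qubits of `I` and the others (`entropy_reduce`,
`countXor_qubits`). -/

/-! ### Cuts of graphs and hypergraphs: monogamy and subadditivity. -/

namespace HypergraphModel

variable {N : ℕ} {V : Type*} [Fintype V] [DecidableEq V]

/-- An edge is cut by `W` if it has a vertex in `W` and a vertex outside `W`. -/
def CutsEdge (W e : Finset V) : Prop := (∃ v ∈ e, v ∈ W) ∧ ∃ v ∈ e, v ∉ W

instance (W e : Finset V) : Decidable (CutsEdge W e) := by
  unfold CutsEdge
  infer_instance

theorem cost_eq_sum_ite (G : HypergraphModel N V) (W : Finset V) :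
    G.cost W = ∑ e ∈ G.edges, if CutsEdge W e then G.weight e else 0 :=
  Finset.sum_filter _ _

theorem entropyVec_le_cost (G : HypergraphModel N V) {I : {I : Finset (Fin N) // I.Nonempty}}
    {W : Finset V} (hW : G.IsCut I.1 W) : G.entropyVec I ≤ G.cost W :=
  Finset.inf'_le _ (by simpa using hW)

theorem exists_isCut_cost_eq (G : HypergraphModel N V)
    (I : {I : Finset (Fin N) // I.Nonempty}) :
    ∃ W, G.IsCut I.1 W ∧ G.cost W = G.entropyVec I := by
  obtain ⟨W, hW, h⟩ := Finset.exists_mem_eq_inf' (G.cuts_nonempty I.1) G.cost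
  exact ⟨W, by simpa using hW, h.symm⟩

theorem entropyVec_eq_of_forall (G : HypergraphModel N V)
    {I : {I : Finset (Fin N) // I.Nonempty}} {r : ℝ} (hle : ∀ W, G.IsCut I.1 W → r ≤ G.cost W)
    (hex : ∃ W, G.IsCut I.1 W ∧ G.cost W = r) : G.entropyVec I = r := by
  obtain ⟨W, hW, rfl⟩ := hex
  obtain ⟨W', hW', h⟩ := G.exists_isCut_cost_eq I
  exact le_antisymm (G.entropyVec_le_cost hW) (h ▸ hle W' hW')

/-- Monogamy of mutual information for the cuts of a graph. -/
theorem IsGraph.cost_mmi {G : HypergraphModel N V} (hG : G.IsGraph) (U W T : Finset V) :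
    G.cost ((U ∩ W) \ T) + G.cost ((U ∩ T) \ W) + G.cost ((W ∩ T) \ U) + G.cost (U ∪ W ∪ T) ≤
      G.cost U + G.cost W + G.cost T := by
  simp only [cost_eq_sum_ite, ← Finset.sum_add_distrib]
  refine Finset.sum_le_sum fun e he => ?_
  have hw := G.weight_pos e he
  obtain ⟨a, b, -, rfl⟩ := Finset.card_eq_two.mp (hG e he)
  generalize G.weight {a, b} = w at hw
  simp only [CutsEdge, Finset.mem_insert, Finset.mem_singleton, exists_eq_or_imp,
    exists_eq_left, Finset.mem_sdiff, Finset.mem_inter, Finset.mem_union]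
  -- Each endpoint has one of eight membership patterns in `U`, `W`, `T`; all 64 combinations
  -- satisfy the inequality for this edge alone.
  by_cases h1 : a ∈ U <;> by_cases h2 : a ∈ W <;> by_cases h3 : a ∈ T <;>
    by_cases h4 : b ∈ U <;> by_cases h5 : b ∈ W <;> by_cases h6 : b ∈ T <;>
    simp only [h1, h2, h3, h4, h5, h6] <;> norm_num <;> linarith

/-- Monogamy of mutual information for the entropies of a graph model. -/
theorem IsGraph.entropyVec_mmi {G : HypergraphModel N V} (hG : G.IsGraph)
    {X Y Z : Finset (Fin N)} (hX : X.Nonempty) (hY : Y.Nonempty) (hZ : Z.Nonempty)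
    (hXY : Disjoint X Y) (hXZ : Disjoint X Z) (hYZ : Disjoint Y Z) :
    G.entropyVec ⟨X, hX⟩ + G.entropyVec ⟨Y, hY⟩ + G.entropyVec ⟨Z, hZ⟩ +
        G.entropyVec ⟨X ∪ Y ∪ Z, (hX.inl).inl⟩ ≤
      G.entropyVec ⟨X ∪ Y, hX.inl⟩ + G.entropyVec ⟨X ∪ Z, hX.inl⟩ +
        G.entropyVec ⟨Y ∪ Z, hY.inl⟩ := by
  obtain ⟨U, hU, hU'⟩ := G.exists_isCut_cost_eq ⟨X ∪ Y, hX.inl⟩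
  obtain ⟨W, hW, hW'⟩ := G.exists_isCut_cost_eq ⟨X ∪ Z, hX.inl⟩
  obtain ⟨T, hT, hT'⟩ := G.exists_isCut_cost_eq ⟨Y ∪ Z, hY.inl⟩
  -- On the boundary, labels in `X`, `Y`, `Z` lie in exactly the two cuts for the unions that
  -- contain them, and all other labels in none. Hence the four derived sets are cuts for `X`, `Y`,
  -- `Z` and the whole union.
  have key : ∀ v : {v // v ∈ G.boundary},
      (v.1 ∈ (U ∩ W) \ T ↔ ∃ i ∈ X, G.label v = i.castSucc) ∧
      (v.1 ∈ (U ∩ T) \ W ↔ ∃ i ∈ Y, G.label v = i.castSucc) ∧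
      (v.1 ∈ (W ∩ T) \ U ↔ ∃ i ∈ Z, G.label v = i.castSucc) ∧
      (v.1 ∈ U ∪ W ∪ T ↔ ∃ i ∈ X ∪ Y ∪ Z, G.label v = i.castSucc) := by
    intro v
    have h1 := hU v
    have h2 := hW v
    have h3 := hT v
    rcases Fin.eq_castSucc_or_eq_last (G.label v) with ⟨j, hj⟩ | hj
    · have d1 : j ∈ X → j ∉ Y := fun h => Finset.disjoint_left.mp hXY h
      have d2 : j ∈ X → j ∉ Z := fun h => Finset.disjoint_left.mp hXZ h
      have d3 : j ∈ Y → j ∉ Z := fun h => Finset.disjoint_left.mp hYZ h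
      simp only [hj, Fin.castSucc_inj, exists_eq_right', Finset.mem_union, Finset.mem_sdiff,
        Finset.mem_inter] at h1 h2 h3 ⊢
      rw [h1, h2, h3]
      by_cases hx : j ∈ X <;> by_cases hy : j ∈ Y <;> by_cases hz : j ∈ Z <;> simp_all
    · have hne : ∀ i : Fin N, Fin.last N ≠ i.castSucc := fun i => (Fin.castSucc_ne_last i).symm
      simp only [hj, hne, and_false, exists_false, iff_false] at h1 h2 h3 ⊢
      simp [h1, h2, h3]
  have h := hG.cost_mmi U W T
  rw [hU', hW', hT'] at h
  have i1 := G.entropyVec_le_cost (I := ⟨X, hX⟩) fun v => (key v).1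
  have i2 := G.entropyVec_le_cost (I := ⟨Y, hY⟩) fun v => (key v).2.1
  have i3 := G.entropyVec_le_cost (I := ⟨Z, hZ⟩) fun v => (key v).2.2.1
  have i4 := G.entropyVec_le_cost (I := ⟨X ∪ Y ∪ Z, (hX.inl).inl⟩) fun v => (key v).2.2.2
  linarith

/-- Cutting along a set or along its complement costs the same. -/
theorem cost_compl (G : HypergraphModel N V) (W : Finset V) : G.cost Wᶜ = G.cost W := by
  simp only [cost, Finset.mem_compl, not_not]
  congr 1
  ext e
  simp [and_comm]

theorem cost_nonneg (G : HypergraphModel N V) (W : Finset V) : 0 ≤ G.cost W :=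
  Finset.sum_nonneg fun e he => (G.weight_pos e (Finset.mem_filter.mp he).1).le

theorem cost_union_le (G : HypergraphModel N V) (U W : Finset V) :
    G.cost (U ∪ W) ≤ G.cost U + G.cost W := by
  simp only [cost_eq_sum_ite, ← Finset.sum_add_distrib]
  refine Finset.sum_le_sum fun e he => ?_
  have hw := G.weight_pos e he
  have h : CutsEdge (U ∪ W) e → CutsEdge U e ∨ CutsEdge W e := by
    simp only [CutsEdge, Finset.mem_union]
    grind
  split_ifs <;> first | linarith | tauto

/-- `W` meets the boundary exactly in the vertices whose label lies in `J`. -/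
def Separates (G : HypergraphModel N V) (J : Finset (Fin (N + 1))) (W : Finset V) : Prop :=
  ∀ v : {v // v ∈ G.boundary}, v.1 ∈ W ↔ G.label v ∈ J

theorem Separates.compl {G : HypergraphModel N V} {J : Finset (Fin (N + 1))} {W : Finset V}
    (h : G.Separates J W) : G.Separates Jᶜ Wᶜ := fun v => by simp [h v]

theorem Separates.union {G : HypergraphModel N V} {J K : Finset (Fin (N + 1))} {W T : Finset V}
    (h : G.Separates J W) (h' : G.Separates K T) : G.Separates (J ∪ K) (W ∪ T) :=
  fun v => by simp [h v, h' v]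

theorem isCut_dropPurifier_iff (G : HypergraphModel N V) (J : Finset (Fin (N + 1)))
    (W : Finset V) :
    G.IsCut (dropPurifier J) W ↔ G.Separates (if Fin.last N ∈ J then Jᶜ else J) W := by
  refine forall_congr' fun v => iff_congr Iff.rfl ?_
  rcases Fin.eq_castSucc_or_eq_last (G.label v) with ⟨j, hj⟩ | hj
  · simp [hj, dropPurifier]
  · have hne : ∀ i : Fin N, Fin.last N ≠ i.castSucc := fun i => (Fin.castSucc_ne_last i).symm
    simp only [hj, hne, and_false, exists_false, false_iff]
    split_ifs with h <;> simpa using h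

/-- Complementing a cut preserves its cost, so the purifier can be treated like any other party,
although `dropPurifier` replaces some subsystems by their complements. -/
theorem exists_isCut_iff_exists_separates (G : HypergraphModel N V) (J : Finset (Fin (N + 1)))
    (r : ℝ) : (∃ W, G.IsCut (dropPurifier J) W ∧ G.cost W = r) ↔
      ∃ W, G.Separates J W ∧ G.cost W = r := by
  simp only [isCut_dropPurifier_iff]
  split_ifs
  · constructor
    · rintro ⟨W, hW, h⟩
      exact ⟨Wᶜ, by simpa using hW.compl, by rw [cost_compl, h]⟩
    · rintro ⟨W, hW, h⟩
      exact ⟨Wᶜ, hW.compl, by rw [cost_compl, h]⟩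
  · rfl

theorem ent_entropyVec_le_cost (G : HypergraphModel N V) {J : Finset (Fin (N + 1))}
    {W : Finset V} (hW : G.Separates J W) : EntropyVec.ent G.entropyVec J ≤ G.cost W := by
  obtain ⟨T, hT, h⟩ := (G.exists_isCut_iff_exists_separates J _).2 ⟨W, hW, rfl⟩
  unfold EntropyVec.ent
  split_ifs with hJ
  · exact (G.entropyVec_le_cost (I := ⟨_, hJ⟩) hT).trans h.le
  · exact G.cost_nonneg W

theorem exists_separates_cost_eq (G : HypergraphModel N V) (J : Finset (Fin (N + 1))) :
    ∃ W, G.Separates J W ∧ G.cost W = EntropyVec.ent G.entropyVec J := by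
  rw [← exists_isCut_iff_exists_separates]
  unfold EntropyVec.ent
  split_ifs with hJ
  · exact G.exists_isCut_cost_eq ⟨_, hJ⟩
  · refine ⟨∅, fun v => ?_, by simp [cost]⟩
    simp [Finset.not_nonempty_iff_eq_empty.mp hJ]

/-- Entropy vectors of hypergraph models are subadditive. -/
theorem entropyVec_mem_subadditivityCone (G : HypergraphModel N V) :
    G.entropyVec ∈ subadditivityCone N := by
  intro I K _
  obtain ⟨U, hU, hU'⟩ := G.exists_separates_cost_eq I
  obtain ⟨W, hW, hW'⟩ := G.exists_separates_cost_eq K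
  have h1 := G.ent_entropyVec_le_cost (hU.union hW)
  have h2 := G.cost_union_le U W
  unfold EntropyVec.mutualInfo
  linarith

end HypergraphModel

/-! ### Violation of monogamy by `R₆`. -/

namespace SixParty

theorem not_realizedByGraphModel_ray : ¬ RealizedByGraphModel ray := by
  rintro ⟨n, G, hG, hS⟩
  have h := hG.entropyVec_mmi (X := {A}) (Y := {B, C}) (Z := {D, E}) (by simp) (by simp)
    (by simp) (by decide) (by decide) (by decide)
  rw [hS] at h
  have e1 : rayTable.lookup {A} = some 2 := by decide +kernel
  have e2 : rayTable.lookup {B, C} = some 2 := by decide +kernel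
  have e3 : rayTable.lookup {D, E} = some 3 := by decide +kernel
  have e4 : rayTable.lookup ({A} ∪ {B, C} ∪ {D, E}) = some 3 := by decide +kernel
  have e5 : rayTable.lookup ({A} ∪ {B, C}) = some 2 := by decide +kernel
  have e6 : rayTable.lookup ({A} ∪ {D, E}) = some 3 := by decide +kernel
  have e7 : rayTable.lookup ({B, C} ∪ {D, E}) = some 3 := by decide +kernel
  simp only [ray, e1, e2, e3, e4, e5, e6, e7, Option.getD_some] at h
  norm_num at h

end SixParty

/-! ### Entropies of subsystems that may contain the purifier. -/

theorem dropPurifier_compl {N : ℕ} (J : Finset (Fin (N + 1))) :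
    dropPurifier Jᶜ = dropPurifier J := by
  unfold dropPurifier
  by_cases h : Fin.last N ∈ J <;> simp [h]

theorem dropPurifier_map_castSucc {N : ℕ} (I : Finset (Fin N)) :
    dropPurifier (I.map Fin.castSuccEmb) = I := by
  ext i
  simp [dropPurifier, Fin.castSucc_ne_last]

namespace EntropyVec

variable {N : ℕ}

theorem ent_compl (S : EntropyVec N) (J : Finset (Fin (N + 1))) : S.ent Jᶜ = S.ent J := by
  unfold ent
  simp only [dropPurifier_compl]

theorem ent_map_castSucc (S : EntropyVec N) (I : {I : Finset (Fin N) // I.Nonempty}) :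
    S.ent (I.1.map Fin.castSuccEmb) = S I := by
  unfold ent
  simp only [dropPurifier_map_castSucc]
  exact dif_pos I.2

/-- Subadditivity for `J` and its complement, which have equal entropy, reads `2 S_J ≥ S_univ = 0`.
-/
theorem ent_nonneg {S : EntropyVec N} (hS : S ∈ subadditivityCone N)
    (J : Finset (Fin (N + 1))) : 0 ≤ S.ent J := by
  have h := hS J Jᶜ disjoint_compl_right
  have h0 : S.ent Finset.univ = 0 := by simp [ent, dropPurifier]
  rw [mutualInfo, ent_compl, ← Finset.sup_eq_union, sup_compl_eq_top, Finset.top_eq_univ, h0] at h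
  linarith

end EntropyVec

/-! ### Computation of the entropies of the hypergraph. -/

namespace SixParty

/-- The component of the vector `R₆` at a subsystem that may contain the purifier. -/
def rayNat (J : Finset (Fin 7)) : ℕ := (rayTable.lookup (dropPurifier J)).getD 0

theorem ent_ray (J : Finset (Fin 7)) : EntropyVec.ent ray J = rayNat J := by
  unfold EntropyVec.ent ray rayNat
  split_ifs with h
  · rfl
  · rw [Finset.not_nonempty_iff_eq_empty.mp h]
    have : rayTable.lookup ∅ = none := by decide +kernel
    simp [this]

/-- Total weight of the hyperedges cut by a set of vertices with indicator function `p`. -/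
def cutCost (p : Fin 10 → Bool) : ℕ :=
  let cut (e : List (Fin 10)) : ℕ := bif e.any p && e.any (fun v => !p v) then 1 else 0
  2 * cut [0, 7, 8, 9] + cut [7, 1] + cut [7, 2] + cut [8, 3] + 2 * cut [8, 4] + cut [8, 5] +
    cut [9, 5] + cut [9, 6]

theorem ite_cutsEdge_toFinset (W : Finset (Fin 10)) (e : List (Fin 10)) (r : ℝ) :
    (if HypergraphModel.CutsEdge W e.toFinset then r else 0) =
      r * ((bif e.any (fun v => decide (v ∈ W)) && e.any (fun v => !decide (v ∈ W))
        then 1 else 0 : ℕ) : ℝ) := by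
  have h : HypergraphModel.CutsEdge W e.toFinset ↔
      (e.any (fun v => decide (v ∈ W)) && e.any (fun v => !decide (v ∈ W))) = true := by
    simp [HypergraphModel.CutsEdge]
  by_cases hc : HypergraphModel.CutsEdge W e.toFinset
  · rw [if_pos hc, h.1 hc]
    simp
  · rw [if_neg hc, Bool.eq_false_iff.2 (mt h.2 hc)]
    simp

theorem cost_hypergraph (W : Finset (Fin 10)) :
    hypergraph.cost W = cutCost fun v => decide (v ∈ W) := by
  rw [HypergraphModel.cost_eq_sum_ite]
  have h := ite_cutsEdge_toFinset W
  have h0 := h [0, 7, 8, 9] 2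
  have h1 := h [7, 1] 1
  have h2 := h [7, 2] 1
  have h3 := h [8, 3] 1
  have h4 := h [8, 4] 2
  have h5 := h [8, 5] 1
  have h6 := h [9, 5] 1
  have h7 := h [9, 6] 1
  simp only [List.toFinset_cons, List.toFinset_nil, insert_empty_eq] at h0 h1 h2 h3 h4 h5 h6 h7
  simp only [hypergraph, cutCost]
  iterate 7 rw [Finset.sum_insert (by decide)]
  rw [Finset.sum_singleton]
  simp only [show ∀ e : Finset (Fin 10), ((e = {0, 7, 8, 9} ∨ e = {8, 4}) ↔
    e ∈ ({{0, 7, 8, 9}, {8, 4}} : Finset (Finset (Fin 10)))) by simp]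
  simp (decide := true) only [if_true, if_false]
  rw [h0, h1, h2, h3, h4, h5, h6, h7]
  push_cast
  ring

/-- Indicator function of the cut for `I` that contains the bulk vertices selected by
`a`, `b`, `c`. -/
def cutIndicator (I : Finset (Fin 6)) (a b c : Bool) (v : Fin 10) : Bool :=
  if h : v.1 < 6 then ⟨v.1, h⟩ ∈ I
  -- The final `false` is the value at vertex `6`, the purifier, which belongs to no cut for a set
  -- of parties.
  else if v = 7 then a else if v = 8 then b else if v = 9 then c else false

theorem isCut_hypergraph_iff (I : Finset (Fin 6)) (W : Finset (Fin 10)) :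
    hypergraph.IsCut I W ↔ ∃ a b c, (fun v => decide (v ∈ W)) = cutIndicator I a b c := by
  have key : ∀ v : {v // v ∈ hypergraph.boundary}, (∃ i ∈ I, hypergraph.label v = i.castSucc) ↔
      ∃ h : v.1.1 < 6, (⟨v.1.1, h⟩ : Fin 6) ∈ I := by
    intro v
    constructor
    · rintro ⟨i, hi, e⟩
      have e' : v.1.1 = i.1 := congrArg Fin.val e
      exact ⟨e' ▸ i.2, by simpa only [e'] using hi⟩
    · rintro ⟨h, hi⟩
      exact ⟨_, hi, rfl⟩
  constructor
  · intro h
    refine ⟨decide (7 ∈ W), decide (8 ∈ W), decide (9 ∈ W), funext fun v => ?_⟩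
    have hv : v.1 < 6 ∨ v = 6 ∨ v = 7 ∨ v = 8 ∨ v = 9 := by omega
    rcases hv with hv | rfl | rfl | rfl | rfl
    · have := (h ⟨v, by simp [hypergraph]; omega⟩).trans (key _)
      simp [cutIndicator, hv, this]
    · have h6 : (6 : Fin 10) ∉ W := fun hW =>
        ((key _).1 ((h ⟨6, by simp [hypergraph]⟩).1 hW)).elim fun h6 _ => absurd h6 (by decide)
      simp [cutIndicator, h6]
    all_goals simp [cutIndicator]
  · rintro ⟨a, b, c, h⟩ v
    rw [key]
    have hv : v.1.1 < 7 := (Finset.mem_filter.mp v.2).2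
    have hW := congrFun h v.1
    by_cases h6 : v.1.1 < 6
    · simpa [cutIndicator, h6] using hW
    · have : v.1 = 6 := by omega
      refine iff_of_false (fun hv => ?_) fun ⟨h, _⟩ => h6 h
      rw [this] at hv hW
      simp [hv, cutIndicator] at hW

-- A finite check over 64 sets and eight cuts each. The empty set has no table entry, and the
-- default `0` is its correct cut value.
set_option maxRecDepth 100000 in
theorem isLeast_cutCost : ∀ I : Finset (Fin 6),
    (∀ a b c, (rayTable.lookup I).getD 0 ≤ cutCost (cutIndicator I a b c)) ∧
      ∃ a b c, cutCost (cutIndicator I a b c) = (rayTable.lookup I).getD 0 := by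
  decide +kernel

theorem entropyVec_hypergraph : hypergraph.entropyVec = ray := by
  funext I
  obtain ⟨hle, a, b, c, h⟩ := isLeast_cutCost I.1
  have hW : (fun v => decide (v ∈ Finset.univ.filter fun v => cutIndicator I.1 a b c v)) =
      cutIndicator I.1 a b c := by simp
  refine hypergraph.entropyVec_eq_of_forall (fun W hW => ?_)
    ⟨_, (isCut_hypergraph_iff _ _).2 ⟨a, b, c, hW⟩, by rw [cost_hypergraph, hW, h, ray]⟩
  obtain ⟨a, b, c, hW'⟩ := (isCut_hypergraph_iff _ _).1 hW
  rw [cost_hypergraph, ray, hW']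
  exact_mod_cast hle a b c

theorem ray_mem_subadditivityCone : ray ∈ subadditivityCone 6 :=
  entropyVec_hypergraph ▸ hypergraph.entropyVec_mem_subadditivityCone

/-! ### Extremality: the saturated instances of subadditivity. -/

/-- Subadditivity of `R₆` is saturated at disjoint subsystems. -/
def Tight (I K : Finset (Fin 7)) : Prop :=
  Disjoint I K ∧ rayNat I + rayNat K = rayNat (I ∪ K)

instance (I K : Finset (Fin 7)) : Decidable (Tight I K) := by
  unfold Tight
  infer_instance

-- Thanks to this, two-party entropies are not independent unknowns in the linear system below.
set_option maxRecDepth 100000 in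
theorem tight_singletons : ∀ i j : Fin 7, i ≠ j → Tight {i} {j} := by
  decide +kernel

/-- The three-party subsystems whose entropies are not determined by those of pairs. -/
def exceptionalTriples : List (Finset (Fin 7)) :=
  [{0, 1, 2}, {0, 3, 4}, {0, 5, 6}, {3, 4, 5}, {4, 5, 6}, {0, 4, 5}]

set_option maxRecDepth 100000 in
theorem exists_tight_erase : ∀ T : Finset (Fin 7), T.card = 3 →
    T ∈ exceptionalTriples ∨ ∃ i ∈ T, Tight {i} (T.erase i) := by
  decide +kernel

theorem card_le_three_or (J : Finset (Fin 7)) : J.card ≤ 3 ∨ Jᶜ.card ≤ 3 := by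
  have := J.card_add_card_compl
  simp only [Fintype.card_fin] at this
  omega

theorem rayNat_compl (J : Finset (Fin 7)) : rayNat Jᶜ = rayNat J := by
  rw [rayNat, dropPurifier_compl, rayNat]

theorem rayNat_one : rayNat {1} = 1 := by decide +kernel

/-- The unknowns `a, …, f, o` stand for the entropies of `A, …, F, O`, and `x`, `y`, `z` for those
of `ABC`, `ADE`, `AFO`. Pairs of equations related by a swap give `c = b` and `f = e`; the rest then
expresses everything through `b`. -/
theorem eq_mul_of_basic_equations {a b c d e f o x y z : ℝ} (h1 : a + b = c + x)
    (h2 : a + c = b + x) (h3 : a + e = d + y) (h4 : a + f = o + z) (h5 : e + f = x + (d + o))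
    (h6 : a + (b + e) = c + d + (f + o)) (h7 : a + (b + f) = c + d + (e + o))
    (h8 : b + c + e = d + z) (h9 : b + c + f = o + y) :
    a = 2 * b ∧ c = b ∧ d = b ∧ e = 2 * b ∧ f = 2 * b ∧ o = b ∧ x = 2 * b ∧ y = 3 * b ∧
      z = 3 * b := by
  have hc : c = b := by linarith
  have hx : x = a := by linarith
  have hf : f = e := by linarith
  have he : e = a := by linarith
  have hd : d = b := by linarith
  have ho : o = b := by linarith
  have ha : a = 2 * b := by linarith
  exact ⟨ha, hc, hd, by linarith, by linarith, ho, by linarith, by linarith, by linarith⟩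

/-- A vector saturating every instance of subadditivity that `R₆` saturates is a multiple
of `R₆`. -/
theorem ent_eq_of_tight {S : EntropyVec 6}
    (hS : ∀ I K, Tight I K → S.ent I + S.ent K = S.ent (I ∪ K)) (J : Finset (Fin 7)) :
    S.ent J = rayNat J * S.ent {1} := by
  have add : ∀ {I K : Finset (Fin 7)} (J : Finset (Fin 7)), S.ent I = rayNat I * S.ent {1} →
      S.ent K = rayNat K * S.ent {1} → Tight I K → I ∪ K = J →
      S.ent J = rayNat J * S.ent {1} := by
    rintro I K _ hI hK h rfl
    rw [← hS I K h, hI, hK, ← h.2]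
    push_cast
    ring
  have compl : ∀ {I : Finset (Fin 7)} (J : Finset (Fin 7)), S.ent I = rayNat I * S.ent {1} →
      Iᶜ = J → S.ent J = rayNat J * S.ent {1} := by
    rintro I _ h rfl
    rw [S.ent_compl, rayNat_compl, h]
  -- Two saturated instances whose unions coincide or are complementary give an equation in which
  -- the entropy of the union is eliminated.
  have eqn : ∀ I K I' K' : Finset (Fin 7), Tight I K ∧ Tight I' K' ∧
      (I ∪ K = I' ∪ K' ∨ I ∪ K = (I' ∪ K')ᶜ) → S.ent I + S.ent K = S.ent I' + S.ent K' := by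
    rintro I K I' K' ⟨h, h', e⟩
    rw [hS _ _ h, hS _ _ h']
    rcases e with e | e
    · rw [e]
    · rw [e, S.ent_compl]
  have pair : ∀ i j : Fin 7, i ≠ j → S.ent {i, j} = S.ent {i} + S.ent {j} :=
    fun i j h => (hS _ _ (tight_singletons i j h)).symm
  have c1 : S.ent {3, 4, 5, 6} = S.ent {0, 1, 2} := by
    rw [← S.ent_compl, show ({3, 4, 5, 6} : Finset (Fin 7))ᶜ = {0, 1, 2} by decide]
  have c2 : S.ent {1, 2, 5, 6} = S.ent {0, 3, 4} := by
    rw [← S.ent_compl, show ({1, 2, 5, 6} : Finset (Fin 7))ᶜ = {0, 3, 4} by decide]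
  have c3 : S.ent {1, 2, 3, 4} = S.ent {0, 5, 6} := by
    rw [← S.ent_compl, show ({1, 2, 3, 4} : Finset (Fin 7))ᶜ = {0, 5, 6} by decide]
  have e1 := eqn {0} {1} {2} {3, 4, 5, 6} (by decide +kernel)
  have e2 := eqn {0} {2} {1} {3, 4, 5, 6} (by decide +kernel)
  have e3 := eqn {0} {4} {3} {1, 2, 5, 6} (by decide +kernel)
  have e4 := eqn {0} {5} {6} {1, 2, 3, 4} (by decide +kernel)
  have e5 := eqn {4} {5} {0, 1, 2} {3, 6} (by decide +kernel)
  have e6 := eqn {0} {1, 4} {2, 3} {5, 6} (by decide +kernel)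
  have e7 := eqn {0} {1, 5} {2, 3} {4, 6} (by decide +kernel)
  have e8 := eqn {1, 2} {4} {3} {0, 5, 6} (by decide +kernel)
  have e9 := eqn {1, 2} {5} {6} {0, 3, 4} (by decide +kernel)
  rw [pair 3 6 (by decide)] at e5
  rw [pair 1 4 (by decide), pair 2 3 (by decide), pair 5 6 (by decide)] at e6
  rw [pair 1 5 (by decide), pair 2 3 (by decide), pair 4 6 (by decide)] at e7
  rw [pair 1 2 (by decide)] at e8 e9
  rw [c1] at e1 e2
  rw [c2] at e3
  rw [c3] at e4
  obtain ⟨s0, s2, s3, s4, s5, s6, s012, s034, s056⟩ :=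
    eq_mul_of_basic_equations e1 e2 e3 e4 e5 e6 e7 e8 e9
  have basic : ∀ (I : Finset (Fin 7)) (r : ℕ), rayNat I = r → S.ent I = r * S.ent {1} →
      S.ent I = rayNat I * S.ent {1} := by
    rintro I _ rfl h
    exact h
  have single : ∀ i : Fin 7, S.ent {i} = rayNat {i} * S.ent {1} := by
    refine Fin.forall_iff_succ.2 ⟨basic _ 2 (by decide +kernel) (mod_cast s0), ?_⟩
    refine Fin.forall_iff_succ.2 ⟨basic _ 1 (by decide +kernel) (by simp), ?_⟩
    refine Fin.forall_iff_succ.2 ⟨basic _ 1 (by decide +kernel) (by simpa using s2), ?_⟩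
    refine Fin.forall_iff_succ.2 ⟨basic _ 1 (by decide +kernel) (by simpa using s3), ?_⟩
    refine Fin.forall_iff_succ.2 ⟨basic _ 2 (by decide +kernel) (mod_cast s4), ?_⟩
    refine Fin.forall_iff_succ.2 ⟨basic _ 2 (by decide +kernel) (mod_cast s5), ?_⟩
    exact Fin.forall_iff_succ.2 ⟨basic _ 1 (by decide +kernel) (by simpa using s6),
      fun i => i.elim0⟩
  have double : ∀ T : Finset (Fin 7), T.card = 2 → S.ent T = rayNat T * S.ent {1} := by
    intro T hT
    obtain ⟨i, j, h, rfl⟩ := Finset.card_eq_two.mp hT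
    exact add _ (single i) (single j) (tight_singletons i j h) rfl
  have t012 := basic {0, 1, 2} 2 (by decide +kernel) (mod_cast s012)
  have t034 := basic {0, 3, 4} 3 (by decide +kernel) (mod_cast s034)
  have t056 := basic {0, 5, 6} 3 (by decide +kernel) (mod_cast s056)
  -- The remaining exceptional triples are reached through their four-party complements, which split
  -- tightly into a known triple and a single party.
  have t345 := compl {3, 4, 5} (add {0, 1, 2, 6} t012 (single 6) (by decide +kernel)
    (by decide)) (by decide)
  have t456 := compl {4, 5, 6} (add {0, 1, 2, 3} t012 (single 3) (by decide +kernel)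
    (by decide)) (by decide)
  have t126 := add {1, 2, 6} (double {1, 2} rfl) (single 6) (by decide +kernel) (by decide)
  have t045 := compl {0, 4, 5} (add {1, 2, 3, 6} t126 (single 3) (by decide +kernel)
    (by decide)) (by decide)
  have triple : ∀ T : Finset (Fin 7), T.card = 3 → S.ent T = rayNat T * S.ent {1} := by
    intro T hT
    rcases exists_tight_erase T hT with h | ⟨i, hi, h⟩
    · simp only [exceptionalTriples, List.mem_cons, List.not_mem_nil, or_false] at h
      rcases h with h | h | h | h | h | h <;> rw [h] <;> assumption
    · refine add _ (single i) (double _ ?_) h ?_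
      · rw [Finset.card_erase_of_mem hi, hT]
      · rw [← Finset.insert_eq, Finset.insert_erase hi]
  have small : ∀ I : Finset (Fin 7), I.card ≤ 3 → S.ent I = rayNat I * S.ent {1} := by
    intro I hI
    rcases Nat.lt_or_ge I.card 1 with h | h
    · rw [Finset.card_eq_zero.mp (Nat.lt_one_iff.mp h)]
      exact basic ∅ 0 (by decide +kernel) (by simp [EntropyVec.ent, dropPurifier])
    obtain h | h | h : I.card = 1 ∨ I.card = 2 ∨ I.card = 3 := by omega
    · obtain ⟨i, rfl⟩ := Finset.card_eq_one.mp h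
      exact single i
    · exact double I h
    · exact triple I h
  -- With seven parties in all, a subsystem or its complement has at most three.
  rcases card_le_three_or J with h | h
  · exact small J h
  · exact compl J (small Jᶜ h) (compl_compl J)

theorem generatesExtremeRay_ray : GeneratesExtremeRay (subadditivityCone 6) ray := by
  refine ⟨fun h => ?_, ?_, ?_⟩
  · have h1 := ent_ray {1}
    rw [rayNat_one, h] at h1
    simp [EntropyVec.ent] at h1
  · rw [PointedCone.hull, Submodule.span_le, Set.singleton_subset_iff]
    exact ray_mem_subadditivityCone
  · intro x y a hx hy ha hxy
    obtain ⟨t, ht⟩ := Submodule.mem_span_singleton.mp hxy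
    have ht' : a • x + y = (t : ℝ) • ray := ht.symm
    have htight : ∀ I K, Tight I K → x.ent I + x.ent K = x.ent (I ∪ K) := by
      rintro I K ⟨hIK, h⟩
      have e : ∀ J, a * x.ent J + y.ent J = t * rayNat J := fun J => by
        rw [← ent_ray, ← EntropyVec.ent_smul, ← EntropyVec.ent_smul, ← ht',
          EntropyVec.ent_add]
      have h1 := hx I K hIK
      have h2 := hy I K hIK
      have h' : (rayNat I + rayNat K : ℝ) = rayNat (I ∪ K) := by exact_mod_cast h
      unfold EntropyVec.mutualInfo at h1 h2
      -- The saturated mutual information vanishes on `a • x + y`, and the contribution of `y` is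
      -- nonnegative, so that of `a • x` is nonpositive.
      have h3 : a * (x.ent I + x.ent K - x.ent (I ∪ K)) ≤ 0 := by
        have := e I
        have := e K
        have := e (I ∪ K)
        have := congrArg ((t : ℝ) * ·) h'
        beta_reduce at this
        linarith
      have := nonpos_of_mul_nonpos_right h3 ha
      linarith
    -- The multiple is the entropy of `B`, since `R₆` has the value 1 there.
    refine Submodule.mem_span_singleton.mpr ⟨⟨x.ent {1}, EntropyVec.ent_nonneg hx _⟩, ?_⟩
    change x.ent {1} • ray = x
    funext I
    rw [Pi.smul_apply, ← x.ent_map_castSucc I, ent_eq_of_tight htight (I.1.map _),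
      ← EntropyVec.ent_map_castSucc ray I, ent_ray, smul_eq_mul, mul_comm]

end SixParty

/-! ### Entropy of flat states -/

/-- A state proportional to a projection has entropy minus the logarithm of the factor. -/
theorem DensityMatrix.entropy_eq_of_mul_self {n : Type*} [Fintype n] [DecidableEq n]
    (ρ : DensityMatrix n) {κ : ℝ} (h : ρ.mat * ρ.mat = (κ : ℂ) • ρ.mat) :
    ρ.entropy = -(Real.log κ / Real.log 2) := by
  have hH := ρ.posSemidef.isHermitian
  have hev : ∀ k, hH.eigenvalues k = 0 ∨ hH.eigenvalues k = κ := by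
    intro k
    have h1 := hH.mulVec_eigenvectorBasis k
    have hv : (hH.eigenvectorBasis k).ofLp ≠ 0 := by
      intro h0
      have := hH.eigenvectorBasis.orthonormal.ne_zero k
      exact this (by ext i; exact congrFun h0 i)
    generalize (hH.eigenvectorBasis k).ofLp = v at h1 hv
    generalize hH.eigenvalues k = l at h1
    have h2 := congrArg (fun A => Matrix.mulVec A v) h
    simp only [← Matrix.mulVec_mulVec, Matrix.smul_mulVec, h1, Matrix.mulVec_smul] at h2
    obtain ⟨i, hi⟩ := Function.ne_iff.mp hv
    have h3 := congrFun h2 i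
    simp only [Pi.smul_apply, Complex.real_smul, smul_eq_mul] at h3
    have h4 : (l : ℂ) * (l - κ) = 0 := by
      refine mul_right_cancel₀ hi ?_
      rw [zero_mul]
      linear_combination h3
    rcases mul_eq_zero.mp h4 with h5 | h5
    · exact Or.inl (by exact_mod_cast h5)
    · exact Or.inr (by exact_mod_cast sub_eq_zero.mp h5)
  have htr : ∑ k, hH.eigenvalues k = 1 := by
    have := hH.trace_eq_sum_eigenvalues
    rw [ρ.trace_eq_one] at this
    refine Complex.ofReal_injective ?_
    rw [Complex.ofReal_one, Complex.ofReal_sum]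
    exact this.symm
  -- Zero eigenvalues are covered because `Real.negMulLog` vanishes at 0.
  have hterm : ∀ k, Real.negMulLog (hH.eigenvalues k) = hH.eigenvalues k * -Real.log κ := by
    intro k
    rcases hev k with h0 | h0 <;> rw [h0] <;> simp [Real.negMulLog]
  rw [DensityMatrix.entropy, Finset.sum_congr rfl fun k _ => hterm k, ← Finset.sum_mul, htr]
  ring

/-! ### Matrices of signs given by a bilinear form over the field with two elements -/

/-- The non-trivial character of the group with two elements. -/
noncomputable def signChar : AddChar (ZMod 2) ℂ :=
  AddChar.zmodChar 2 (ζ := -1) (by norm_num)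

theorem signChar_eq_one_or (t : ZMod 2) : signChar t = 1 ∨ signChar t = -1 := by
  rw [signChar, AddChar.zmodChar_apply]
  exact neg_one_pow_eq_or ℂ _

theorem star_signChar (t : ZMod 2) : star (signChar t) = signChar t := by
  rcases signChar_eq_one_or t with h | h <;> simp [h]

theorem signChar_mul_self (t : ZMod 2) : signChar t * signChar t = 1 := by
  rcases signChar_eq_one_or t with h | h <;> simp [h]

theorem signChar_eq_one_iff (t : ZMod 2) : signChar t = 1 ↔ t = 0 := by
  rw [signChar, AddChar.zmodChar_apply]
  obtain rfl | rfl : t = 0 ∨ t = 1 := by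
    revert t
    decide
  · simp
  · rw [ZMod.val_one]
    norm_num

-- Orthogonality of characters: `h ↦ (-1) ^ B g h` is a character of `H`, trivial exactly when `g`
-- is in the left kernel of `B`.
open Classical in
theorem sum_signChar_bilinear {G H : Type*} [AddCommGroup H] [Fintype H] {B : G → H → ZMod 2}
    (hH : ∀ g h h', B g (h + h') = B g h + B g h') (g : G) :
    ∑ h, signChar (B g h) = if ∀ h, B g h = 0 then (Fintype.card H : ℂ) else 0 := by
  have := AddChar.sum_eq_ite (signChar.compAddMonoidHom (AddMonoidHom.mk' (B g) (hH g)))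
  simp only [AddChar.compAddMonoidHom_apply, AddMonoidHom.mk'_apply] at this
  rw [this]
  refine if_congr ?_ rfl rfl
  rw [AddChar.ext_iff]
  simp [signChar_eq_one_iff]

section Bilinear

variable {G H : Type*} [AddCommGroup G] [Fintype G] [AddCommGroup H] [Fintype H]
  {B : G → H → ZMod 2}

-- The inner sum vanishes unless `g + g'` is in the left kernel of `B`. Then `g'` has the same signs
-- as `g`, and there are as many such `g'` as kernel elements.
open Classical in
theorem sum_sum_signChar_bilinear (hG : ∀ g g' h, B (g + g') h = B g h + B g' h)
    (hH : ∀ g h h', B g (h + h') = B g h + B g h') (g : G) (h : H) :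
    ∑ g', (∑ h', signChar (B g h') * signChar (B g' h')) * signChar (B g' h) =
      Fintype.card H * (Finset.univ.filter fun g => ∀ h, B g h = 0).card * signChar (B g h) := by
  have h1 : ∀ g', (∑ h', signChar (B g h') * signChar (B g' h')) * signChar (B g' h) =
      (if ∀ h, B (g + g') h = 0 then (Fintype.card H : ℂ) else 0) * signChar (B g h) := by
    intro g'
    simp only [← AddChar.map_add_eq_mul, ← hG]
    rw [sum_signChar_bilinear hH]
    split_ifs with h0
    · have : B g' h = B g h := by
        have := h0 h
        rw [hG] at this
        exact (CharTwo.add_eq_zero.mp this).symm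
      rw [this]
    · simp
  rw [Finset.sum_congr rfl fun g' _ => h1 g', ← Finset.sum_mul]
  congr 1
  rw [Fintype.sum_equiv (Equiv.addLeft g) (fun k => if ∀ h, B (g + k) h = 0 then
    (Fintype.card H : ℂ) else 0) (fun k => if ∀ h, B k h = 0 then (Fintype.card H : ℂ) else 0)
    fun _ => rfl]
  rw [← Finset.sum_filter, Finset.sum_const, nsmul_eq_mul, mul_comm]

open Classical in
/-- The square of `M * Mᴴ` for a matrix `M` whose entries are signs given by a bilinear form, up to
signs depending only on the row or only on the column. -/
theorem mul_conjTranspose_sq_of_bilinear {α γ : Type*} [Fintype α] [Fintype γ] (eα : α ≃ G)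
    (eγ : γ ≃ H) (hG : ∀ g g' h, B (g + g') h = B g h + B g' h)
    (hH : ∀ g h h', B g (h + h') = B g h + B g h') (s : ℝ) (φ : α → ZMod 2) (ψ : γ → ZMod 2)
    (M : Matrix α γ ℂ)
    (hM : ∀ a c, M a c = s * signChar (φ a + ψ c + B (eα a) (eγ c))) :
    (M * M.conjTranspose) * (M * M.conjTranspose) =
      ((s ^ 2 * Fintype.card γ * (Finset.univ.filter fun g => ∀ h, B g h = 0).card : ℝ) : ℂ) •
        (M * M.conjTranspose) := by
  -- It suffices that `M` is a multiple of a partial isometry.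
  have key : M * M.conjTranspose * M =
      ((s ^ 2 * Fintype.card γ * (Finset.univ.filter fun g => ∀ h, B g h = 0).card : ℝ) : ℂ) •
        M := by
    ext a c
    have hterm : ∀ a', (∑ c', M a c' * star (M a' c')) * M a' c = s ^ 3 * signChar (φ a + ψ c) *
        ((∑ c', signChar (B (eα a) (eγ c')) * signChar (B (eα a') (eγ c'))) *
          signChar (B (eα a') (eγ c))) := by
      intro a'
      rw [Finset.sum_mul, Finset.sum_mul, Finset.mul_sum]
      refine Finset.sum_congr rfl fun c' _ => ?_
      simp only [hM, star_mul', star_signChar, AddChar.map_add_eq_mul, Complex.star_def,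
        Complex.conj_ofReal]
      have e1 := signChar_mul_self (φ a')
      have e2 := signChar_mul_self (ψ c')
      linear_combination (s ^ 3 * signChar (φ a) * signChar (ψ c) *
        signChar (B (eα a) (eγ c')) * signChar (B (eα a') (eγ c')) *
          signChar (B (eα a') (eγ c))) * (signChar (ψ c') * signChar (ψ c') * e1 + e2)
    -- The signs `φ a'` and `ψ c'` of the summation indices have cancelled in pairs; only the
    -- bilinear signs remain to be summed.
    simp only [Matrix.mul_apply, Matrix.conjTranspose_apply, Matrix.smul_apply, smul_eq_mul]
    rw [Finset.sum_congr rfl fun a' _ => hterm a', ← Finset.mul_sum]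
    rw [Fintype.sum_equiv eα _ (fun g' =>
      (∑ h', signChar (B (eα a) h') * signChar (B g' h')) * signChar (B g' (eγ c)))
      fun a' => by
        rw [Fintype.sum_equiv eγ _
          (fun h' => signChar (B (eα a) h') * signChar (B (eα a') h')) fun _ => rfl]]
    rw [sum_sum_signChar_bilinear hG hH, hM, Fintype.card_congr eγ]
    simp only [AddChar.map_add_eq_mul]
    push_cast
    ring
  rw [← Matrix.mul_assoc, key, Matrix.smul_mul]

end Bilinear

/-! ### Graph states -/

namespace GraphState

variable {Q : Type*} [Fintype Q] [DecidableEq Q]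

/-- The quadratic form of a matrix over the field with two elements. -/
def quad (U : Matrix Q Q (ZMod 2)) (x : Q → ZMod 2) : ZMod 2 := x ⬝ᵥ (U.mulVec x)

/-- The polar form of `quad U`. -/
def polar (U : Matrix Q Q (ZMod 2)) (x y : Q → ZMod 2) : ZMod 2 :=
  y ⬝ᵥ ((U + U.transpose).mulVec x)

omit [DecidableEq Q] in
-- Across a bipartition of the qubits, the phase of the graph state splits into a term for each
-- side, which does not affect the entropy, and the bilinear term `polar`.
theorem quad_add (U : Matrix Q Q (ZMod 2)) (x y : Q → ZMod 2) :
    quad U (x + y) = quad U x + quad U y + polar U x y := by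
  simp only [quad, polar, Matrix.mulVec_add, Matrix.add_mulVec, add_dotProduct, dotProduct_add]
  rw [show y ⬝ᵥ (U.transpose.mulVec x) = x ⬝ᵥ (U.mulVec y) by
    rw [Matrix.mulVec_transpose, dotProduct_comm, ← Matrix.dotProduct_mulVec]]
  ring

omit [DecidableEq Q] in
theorem polar_add_left (U : Matrix Q Q (ZMod 2)) (x x' y : Q → ZMod 2) :
    polar U (x + x') y = polar U x y + polar U x' y := by
  simp only [polar, Matrix.mulVec_add, dotProduct_add]

omit [DecidableEq Q] in
theorem polar_add_right (U : Matrix Q Q (ZMod 2)) (x y y' : Q → ZMod 2) :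
    polar U x (y + y') = polar U x y + polar U x y' := by
  simp only [polar, add_dotProduct]

theorem polar_single (U : Matrix Q Q (ZMod 2)) (x : Q → ZMod 2) (q : Q) :
    polar U x (Pi.single q 1) = (U + U.transpose).mulVec x q := by
  simp [polar]

/-- The vectors supported on the qubits with the property `P`. -/
def supported (P : Q → Prop) : AddSubgroup (Q → ZMod 2) where
  carrier := {x | ∀ q, ¬ P q → x q = 0}
  add_mem' hx hy q hq := by simp [hx q hq, hy q hq]
  zero_mem' _ _ := rfl
  neg_mem' hx q hq := by simp [hx q hq]

omit [Fintype Q] [DecidableEq Q] in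
theorem mem_supported {P : Q → Prop} {x : Q → ZMod 2} :
    x ∈ supported P ↔ ∀ q, ¬ P q → x q = 0 := Iff.rfl

omit [Fintype Q] in
theorem single_mem_supported {P : Q → Prop} {q : Q} (hq : P q) :
    Pi.single q 1 ∈ supported P := by
  intro q' hq'
  refine Pi.single_eq_of_ne ?_ _
  rintro rfl
  exact hq' hq

noncomputable instance (P : Q → Prop) : Fintype (supported P) := Fintype.ofFinite _

variable {N : ℕ} (own : Q → Fin (N + 1))

/-- Dimension of the Hilbert space of a party which owns the qubits `own ⁻¹' {i}`. -/
abbrev localDim (i : Fin N) : ℕ := Fintype.card ({q // own q = i.castSucc} → ZMod 2)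

/-- The bits that make up a basis label of a party. -/
noncomputable def bits (i : Fin N) :
    Fin (localDim own i) ≃ ({q // own q = i.castSucc} → ZMod 2) := (Fintype.equivFin _).symm

/-- The bits of one party, extended by zero to all qubits. -/
noncomputable def embed (i : Fin N) (u : Fin (localDim own i)) (q : Q) : ZMod 2 :=
  if h : own q = i.castSucc then bits own i u ⟨q, h⟩ else 0

/-- The bits of the parties with property `p`, extended by zero to all qubits. -/
noncomputable def labelVec (p : Fin N → Prop) [DecidablePred p]
    (a : (i : {i // p i}) → Fin (localDim own i)) : Q → ZMod 2 := ∑ i : {i // p i}, embed own i.1 (a i)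

theorem labelVec_apply (p : Fin N → Prop) [DecidablePred p]
    (a : (i : {i // p i}) → Fin (localDim own i)) (i : {i // p i}) {q : Q}
    (hq : own q = i.1.castSucc) : labelVec own p a q = bits own i (a i) ⟨q, hq⟩ := by
  rw [labelVec, Finset.sum_apply, Finset.sum_eq_single i]
  · simp [embed, hq]
  · intro j _ hj
    have : ¬ own q = j.1.castSucc := by
      rw [hq, Fin.castSucc_inj]
      exact fun h => hj (Subtype.ext h.symm)
    simp [embed, this]
  · simp

theorem labelVec_mem_supported (p : Fin N → Prop) [DecidablePred p]
    (a : (i : {i // p i}) → Fin (localDim own i)) :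
    labelVec own p a ∈ supported fun q => ∃ i, p i ∧ own q = i.castSucc := by
  intro q hq
  rw [labelVec, Finset.sum_apply]
  refine Finset.sum_eq_zero fun i _ => ?_
  simp [embed, show ¬ own q = i.1.castSucc from fun h => hq ⟨i.1, i.2, h⟩]

/-- Basis labels of a set of parties correspond to vectors supported on their qubits. -/
noncomputable def labelEquiv (p : Fin N → Prop) [DecidablePred p] :
    ((i : {i // p i}) → Fin (localDim own i)) ≃
      supported fun q => ∃ i, p i ∧ own q = i.castSucc :=
  Equiv.ofBijective (fun a => ⟨labelVec own p a, labelVec_mem_supported own p a⟩) <| by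
    constructor
    · intro a b hab
      funext i
      refine (bits own i).injective (funext fun q => ?_)
      have : labelVec own p a q.1 = labelVec own p b q.1 := congrFun (congrArg Subtype.val hab) q.1
      rwa [labelVec_apply own p a i q.2, labelVec_apply own p b i q.2] at this
    · intro x
      refine ⟨fun i => (bits own i).symm fun q => x.1 q, Subtype.ext (funext fun q => ?_)⟩
      by_cases hq : ∃ i, p i ∧ own q = i.castSucc
      · obtain ⟨i, hi, hq⟩ := hq
        simp [labelVec_apply own p _ ⟨i, hi⟩ hq]
      · rw [x.2 q hq]
        exact labelVec_mem_supported own p _ q hq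

theorem sum_embed_joinLabels (I : Finset (Fin N)) (a : (i : {i // i ∈ I}) → Fin (localDim own i))
    (c : (i : {i // i ∉ I}) → Fin (localDim own i)) :
    ∑ i, embed own i (joinLabels I a c i) =
      labelVec own (· ∈ I) a + labelVec own (· ∉ I) c := by
  rw [← Fintype.sum_subtype_add_sum_subtype (· ∈ I)]
  congr 1
  · exact Finset.sum_congr rfl fun i _ => by simp only [joinLabels, dif_pos i.2]
  · exact Finset.sum_congr rfl fun i _ => by simp only [joinLabels, dif_neg i.2]

/-- Configurations of the qubits of the purifier. -/
abbrev Purifier : Type _ := supported fun q => own q = Fin.last N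

variable (U : Matrix Q Q (ZMod 2))

/-- Normalization of the graph state vector. -/
noncomputable def amplitude : ℝ :=
  (√(Fintype.card ((i : Fin N) → Fin (localDim own i)) * Fintype.card (Purifier own)))⁻¹

theorem amplitude_sq : amplitude own ^ 2 *
    (Fintype.card ((i : Fin N) → Fin (localDim own i)) * Fintype.card (Purifier own)) = 1 := by
  have h : (0 : ℝ) < Fintype.card ((i : Fin N) → Fin (localDim own i)) *
      Fintype.card (Purifier own) := by
    have : Nonempty ((i : Fin N) → Fin (localDim own i)) := ⟨fun i => (bits own i).symm 0⟩
    have h1 : 0 < Fintype.card ((i : Fin N) → Fin (localDim own i)) := Fintype.card_pos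
    have h2 : 0 < Fintype.card (Purifier own) := Fintype.card_pos
    positivity
  rw [amplitude, inv_pow, Real.sq_sqrt h.le, inv_mul_cancel₀ h.ne']

/-- The graph state vector, as a matrix from the purifier to the parties. -/
noncomputable def stateVec : Matrix ((i : Fin N) → Fin (localDim own i)) (Purifier own) ℂ :=
  Matrix.of fun x z => amplitude own * signChar (quad U (∑ i, embed own i (x i) + z))

/-- The state of the parties obtained by tracing out the purifier from a graph state. -/
noncomputable def state : DensityMatrix ((i : Fin N) → Fin (localDim own i)) where
  mat := stateVec own U * (stateVec own U).conjTranspose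
  posSemidef := Matrix.posSemidef_self_mul_conjTranspose _
  trace_eq_one := by
    have h : ∀ x z, stateVec own U x z * star (stateVec own U x z) =
        ((amplitude own ^ 2 : ℝ) : ℂ) := by
      intro x z
      simp only [stateVec, Matrix.of_apply, star_mul', star_signChar, Complex.star_def,
        Complex.conj_ofReal]
      push_cast
      linear_combination (amplitude own : ℂ) ^ 2 * signChar_mul_self _
    simp only [Matrix.trace, Matrix.diag_apply, Matrix.mul_apply, Matrix.conjTranspose_apply, h,
      Finset.sum_const, Finset.card_univ, nsmul_eq_mul]
    rw [← Complex.ofReal_one, ← amplitude_sq own]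
    push_cast
    ring

/-- The graph state vector, as a matrix from the complement of `I` to `I`. -/
noncomputable def cutMatrix (I : Finset (Fin N)) :
    Matrix ((i : {i // i ∈ I}) → Fin (localDim own i))
      (((i : {i // i ∉ I}) → Fin (localDim own i)) × Purifier own) ℂ :=
  Matrix.of fun a c => stateVec own U (joinLabels I a c.1) c.2

theorem reduce_mat (I : Finset (Fin N)) : ((state own U).reduce I).mat =
    cutMatrix own U I * (cutMatrix own U I).conjTranspose := by
  ext a b
  simp [DensityMatrix.reduce, partialTrace, state, Matrix.mul_apply, cutMatrix,
    Fintype.sum_prod_type]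

open Classical in
/-- The entropy of a set of parties in a graph state, in terms of the number of vectors in the
kernel of the block of the adjacency matrix between these parties and the rest. -/
theorem entropy_reduce (I : Finset (Fin N)) : ((state own U).reduce I).entropy =
    -(Real.log ((Finset.univ.filter fun x : Q → ZMod 2 =>
        (∀ q, (¬ ∃ i, i ∈ I ∧ own q = i.castSucc) → x q = 0) ∧
          ∀ q, (¬ ∃ i, i ∈ I ∧ own q = i.castSucc) → (U + U.transpose).mulVec x q = 0).card /
      Fintype.card (supported fun q => ∃ i, i ∈ I ∧ own q = i.castSucc)) / Real.log 2) := by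
  set G := supported fun q => ∃ i, i ∈ I ∧ own q = i.castSucc
  let B : G → (supported (fun q => ∃ i, i ∉ I ∧ own q = i.castSucc)) × Purifier own → ZMod 2 :=
    fun g h => polar U g (h.1 + h.2)
  have hM := mul_conjTranspose_sq_of_bilinear (B := B) (labelEquiv own (· ∈ I))
    ((labelEquiv own (· ∉ I)).prodCongr (Equiv.refl _))
    (fun g g' h => polar_add_left U _ _ _)
    (fun g h h' => by
      change polar U g ((h.1.1 + h'.1.1) + (h.2.1 + h'.2.1)) = _
      rw [add_add_add_comm, polar_add_right])
    (amplitude own) (fun a => quad U (labelVec own (· ∈ I) a))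
    (fun c => quad U (labelVec own (· ∉ I) c.1 + c.2)) (cutMatrix own U I) (fun a c => by
      rw [cutMatrix, Matrix.of_apply, stateVec, Matrix.of_apply, sum_embed_joinLabels, add_assoc,
        quad_add]
      rfl)
  rw [← reduce_mat] at hM
  rw [DensityMatrix.entropy_eq_of_mul_self _ hM]
  have hcard : (Finset.univ.filter fun g : G => ∀ h, B g h = 0).card =
      (Finset.univ.filter fun x : Q → ZMod 2 =>
        (∀ q, (¬ ∃ i, i ∈ I ∧ own q = i.castSucc) → x q = 0) ∧
          ∀ q, (¬ ∃ i, i ∈ I ∧ own q = i.castSucc) →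
            (U + U.transpose).mulVec x q = 0).card := by
    refine Finset.card_bij (fun g _ => g.1) (fun g hg => ?_) (fun _ _ _ _ h => Subtype.ext h)
      (fun x hx => ?_)
    · refine Finset.mem_filter.mpr ⟨Finset.mem_univ _, g.2, fun q hq => ?_⟩
      have hg := (Finset.mem_filter.mp hg).2
      rw [← polar_single]
      -- Testing against unit vectors turns orthogonality into vanishing coordinates; a qubit
      -- outside `I` belongs to another party or to the purifier.
      rcases Fin.eq_castSucc_or_eq_last (own q) with ⟨j, hj⟩ | hj
      · have hjI : j ∉ I := fun h => hq ⟨j, h, hj⟩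
        have h : polar U g (Pi.single q 1 + 0) = 0 :=
          hg (⟨Pi.single q 1, single_mem_supported ⟨j, hjI, hj⟩⟩, 0)
        rwa [add_zero] at h
      · have h : polar U g (0 + Pi.single q 1) = 0 :=
          hg (0, ⟨Pi.single q 1, single_mem_supported hj⟩)
        rwa [zero_add] at h
    · obtain ⟨-, hx, hx'⟩ := Finset.mem_filter.mp hx
      refine ⟨⟨x, hx⟩, Finset.mem_filter.mpr ⟨Finset.mem_univ _, fun h => ?_⟩, rfl⟩
      refine Finset.sum_eq_zero fun q _ => ?_
      by_cases hq : ∃ i, i ∈ I ∧ own q = i.castSucc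
      · obtain ⟨i, hi, hq⟩ := hq
        have h1 : h.1.1 q = 0 := h.1.2 q (by
          rintro ⟨j, hj, hj'⟩
          rw [hq, Fin.castSucc_inj] at hj'
          exact hj (hj' ▸ hi))
        have h2 : h.2.1 q = 0 := h.2.2 q fun h => Fin.castSucc_ne_last i (hq.symm.trans h)
        rw [Pi.add_apply, h1, h2, add_zero, zero_mul]
      · rw [hx' q hq, mul_zero]
  rw [hcard]
  congr 3
  -- By normalization, the squared amplitude times the dimension of the complementary side, purifier
  -- included, is the inverse of the cardinality of `G`.
  have h1 := amplitude_sq own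
  have h2 : Fintype.card ((i : Fin N) → Fin (localDim own i)) =
      Fintype.card G * Fintype.card ((i : {i // i ∉ I}) → Fin (localDim own i)) := by
    rw [Fintype.card_congr (Equiv.piEquivPiSubtypeProd (· ∈ I) _), Fintype.card_prod,
      Fintype.card_congr (labelEquiv own (· ∈ I))]
  rw [h2] at h1
  have hG : (0 : ℝ) < Fintype.card G := by exact_mod_cast Fintype.card_pos
  rw [Fintype.card_prod, eq_div_iff hG.ne']
  push_cast at h1 ⊢
  linear_combination (((Finset.univ.filter fun x : Q → ZMod 2 =>
    (∀ q, (¬ ∃ i, i ∈ I ∧ own q = i.castSucc) → x q = 0) ∧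
      ∀ q, (¬ ∃ i, i ∈ I ∧ own q = i.castSucc) →
        (U + U.transpose).mulVec x q = 0).card : ℕ) : ℝ) * h1

end GraphState

/-! ### Counting kernel vectors over the field with two elements with bit masks. -/

namespace GraphState

/-- A bit of a natural number. -/
def bit (t k : ℕ) : ZMod 2 := if t.testBit k then 1 else 0

theorem bit_xor (s t k : ℕ) : bit (s ^^^ t) k = bit s k + bit t k := by
  unfold bit
  rw [Nat.testBit_xor]
  cases s.testBit k <;> cases t.testBit k <;> decide

/-- The number of subsets of the list `l` for which the sum of `t` and the rows indexed by the
subset, added bitwise, passes the test. -/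
def countXor {Q : Type*} (row : Q → ℕ) (test : ℕ → Bool) : List Q → ℕ → ℕ
  | [], t => bif test t then 1 else 0
  | q :: l, t => countXor row test l t + countXor row test l (t ^^^ row q)

theorem countXor_true {Q : Type*} (row : Q → ℕ) (l : List Q) (t : ℕ) :
    countXor row (fun _ => true) l t = 2 ^ l.length := by
  induction l generalizing t with
  | nil => rfl
  | cons q l ih => rw [countXor, ih, ih, List.length_cons, pow_succ, mul_two]

variable {Q : Type*} [Fintype Q] [DecidableEq Q]

/-- The mask `t` accumulates the image of the bits already chosen. By `hF`, setting bit `q` has the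
same effect as adding `row q` to `t`, which matches the recursion of `countXor`. -/
theorem card_eq_countXor (row : Q → ℕ) (test : ℕ → Bool) (F : (Q → ZMod 2) → ℕ → Prop)
    [∀ x t, Decidable (F x t)] (h0 : ∀ t, F 0 t ↔ test t = true)
    (hF : ∀ x t q, F (x + Pi.single q 1) t ↔ F x (t ^^^ row q)) (l : List Q) (hl : l.Nodup)
    (t : ℕ) : (Finset.univ.filter fun x : Q → ZMod 2 => (∀ q, q ∉ l → x q = 0) ∧ F x t).card =
      countXor row test l t := by
  induction l generalizing t with
  | nil =>
    have : (Finset.univ.filter fun x : Q → ZMod 2 => (∀ q, q ∉ ([] : List Q) → x q = 0) ∧ F x t) =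
        if test t then {0} else ∅ := by
      ext x
      simp only [List.not_mem_nil, not_false_eq_true, forall_const, Finset.mem_filter,
        Finset.mem_univ, true_and, ← funext_iff]
      have h := h0 t
      constructor
      · rintro ⟨hx, hxF⟩
        obtain rfl : x = 0 := hx
        simp [h.1 hxF]
      · split_ifs with ht
        · intro hx
          obtain rfl := Finset.mem_singleton.mp hx
          exact ⟨rfl, h.2 ht⟩
        · simp
    rw [this, countXor]
    cases test t <;> rfl
  | cons q l ih =>
    obtain ⟨hq, hl⟩ := List.nodup_cons.mp hl
    rw [countXor, ← ih hl, ← ih hl, ← Finset.card_filter_add_card_filter_not (fun x => x q = 0)]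
    congr 1
    · congr 1
      ext x
      simp only [Finset.mem_filter, Finset.mem_univ, true_and, List.mem_cons, not_or]
      constructor
      · rintro ⟨⟨h, hx⟩, hxq⟩
        refine ⟨fun r hr => ?_, hx⟩
        by_cases hrq : r = q
        · rw [hrq, hxq]
        · exact h r ⟨hrq, hr⟩
      · rintro ⟨h, hx⟩
        exact ⟨⟨fun r hr => h r hr.2, hx⟩, h q hq⟩
    · have hadd : ∀ x : Q → ZMod 2, x + Pi.single q 1 + Pi.single q 1 = x := fun x => by
        rw [add_assoc, ← Pi.single_add, CharTwo.add_self_eq_zero, Pi.single_zero, add_zero]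
      -- Toggling the bit `q` is an involution matching vectors with `x q ≠ 0` to those with `x q =
      -- 0`.
      refine Finset.card_nbij' (· + Pi.single q 1) (· + Pi.single q 1) ?_ ?_
        (fun x _ => hadd x) (fun x _ => hadd x)
      · intro x hx
        simp only [Finset.coe_filter, Finset.mem_filter, Finset.mem_univ, true_and, List.mem_cons,
          not_or, Set.mem_ofPred_eq] at hx ⊢
        obtain ⟨⟨h, hx⟩, hxq⟩ := hx
        refine ⟨fun r hr => ?_, (hF _ _ _).1 ((hadd x).symm ▸ hx)⟩
        by_cases hrq : r = q
        · have : ∀ s : ZMod 2, s ≠ 0 → s + 1 = 0 := by decide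
          rw [hrq, Pi.add_apply, Pi.single_eq_same]
          exact this _ hxq
        · rw [Pi.add_apply, Pi.single_eq_of_ne hrq, add_zero, h r ⟨hrq, hr⟩]
      · intro x hx
        simp only [Finset.coe_filter, Finset.mem_filter, Finset.mem_univ, true_and, List.mem_cons,
          not_or, Set.mem_ofPred_eq] at hx ⊢
        obtain ⟨h, hx⟩ := hx
        refine ⟨⟨fun r hr => ?_, (hF _ _ _).2 hx⟩, ?_⟩
        · rw [Pi.add_apply, Pi.single_eq_of_ne hr.1, add_zero, h r hr.2]
        · rw [Pi.add_apply, Pi.single_eq_same, h q hq]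
          decide

end GraphState

/-! ### The ten-qubit graph state realizing `R₆`. -/

namespace SixParty

open GraphState

/-- The rows of the adjacency matrix of a graph on ten qubits, as bit masks. -/
def adjacencyRow (q : Fin 10) : ℕ :=
  [642, 653, 202, 582, 672, 912, 268, 311, 736, 315].getD q 0

/-- The parties (and the purifier) owning the qubits. -/
def owner (q : Fin 10) : Fin 7 := [0, 0, 1, 2, 3, 4, 4, 5, 5, 6].getD q 0

/-- The edges of the graph, each directed towards the larger vertex. -/
def upperAdjacency : Matrix (Fin 10) (Fin 10) (ZMod 2) :=
  Matrix.of fun k q => if k < q then bit (adjacencyRow q) k else 0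

/-- This amounts to the bit masks forming a symmetric matrix with zero diagonal. -/
theorem upperAdjacency_add_transpose (k q : Fin 10) :
    (upperAdjacency + upperAdjacency.transpose) k q = bit (adjacencyRow q) k := by
  have h : ∀ k q : Fin 10, (if k < q then bit (adjacencyRow q) k else 0) +
      (if q < k then bit (adjacencyRow k) q else 0) = bit (adjacencyRow q) k := by
    decide +kernel
  exact h k q

/-- The qubits owned by the parties in `I`. -/
def qubits (I : Finset (Fin 6)) : List (Fin 10) :=
  (List.finRange 10).filter fun q => ∃ i, i ∈ I ∧ owner q = i.castSucc

/-- The bits of `t` at the qubits not owned by the parties in `I` vanish. -/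
def outerBitsVanish (I : Finset (Fin 6)) (t : ℕ) : Bool :=
  ((List.finRange 10).filter fun q => ¬ ∃ i, i ∈ I ∧ owner q = i.castSucc).all
    fun q => !t.testBit q

/-- The count is the size of the kernel of the adjacency block, so by rank-nullity this says that
the rank of the block is the component of `R₆`. -/
theorem countXor_qubits : ∀ I : Finset (Fin 6),
    countXor adjacencyRow (outerBitsVanish I) (qubits I) 0 * 2 ^ (rayTable.lookup I).getD 0 =
      2 ^ (qubits I).length := by
  decide +kernel

theorem entropyVec_state : (state owner upperAdjacency).entropyVec = ray := by
  classical
  funext I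
  have hmem : ∀ q, (¬ ∃ i, i ∈ I.1 ∧ owner q = i.castSucc) ↔ q ∉ qubits I.1 := by
    simp [qubits]
  have hnodup : (qubits I.1).Nodup := (List.nodup_finRange 10).filter _
  have h1 := card_eq_countXor adjacencyRow (outerBitsVanish I.1)
    (fun x t => ∀ q, (¬ ∃ i, i ∈ I.1 ∧ owner q = i.castSucc) →
      (upperAdjacency + upperAdjacency.transpose).mulVec x q + bit t q = 0)
    (fun t => by
      simp only [Matrix.mulVec_zero, Pi.zero_apply, zero_add, outerBitsVanish, bit]
      simp [or_iff_not_imp_left])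
    (fun x t q => by
      refine forall_congr' fun k => imp_congr_right fun _ => ?_
      rw [Matrix.mulVec_add, Pi.add_apply, Matrix.mulVec_single_one, Matrix.col_apply,
        upperAdjacency_add_transpose, bit_xor, add_assoc, add_comm (bit (adjacencyRow q) k)])
    (qubits I.1) hnodup 0
  -- With the trivial test, the same count gives the number of all vectors supported on the qubits
  -- of `I`.
  have h2 := card_eq_countXor adjacencyRow (fun _ => true) (fun _ _ => True) (by simp) (by simp)
    (qubits I.1) hnodup 0
  rw [countXor_true] at h2
  have h3 : Fintype.card (supported fun q => ∃ i, i ∈ I.1 ∧ owner q = i.castSucc) =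
      2 ^ (qubits I.1).length := by
    rw [← h2]
    refine Fintype.card_of_subtype _ fun x => ?_
    simp only [Finset.mem_filter, Finset.mem_univ, true_and, and_true, mem_supported, hmem]
  have h4 := countXor_qubits I.1
  rw [← h1, ← h3] at h4
  simp only [bit, Nat.zero_testBit, Bool.false_eq_true, if_false, add_zero, ← hmem] at h4
  rw [DensityMatrix.entropyVec, entropy_reduce, ray, ← h4]
  have h5 : (Fintype.card (supported fun q => ∃ i, i ∈ I.1 ∧ owner q = i.castSucc) : ℝ) ≠ 0 := by
    rw [h3]
    positivity
  rw [← h4] at h5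
  push_cast at h5 ⊢
  -- The kernel makes up the fraction `2 ^ (-S_I)` of the supported vectors, and minus its binary
  -- logarithm is the entropy.
  rw [div_mul_cancel_left₀ (left_ne_zero_of_mul h5), Real.log_inv, Real.log_pow]
  have h6 : Real.log 2 ≠ 0 := (Real.log_pos one_lt_two).ne'
  field_simp

end SixParty

theorem mainTheorem1 :
    GeneratesExtremeRay (subadditivityCone 6) SixParty.ray ∧
    (∃ (d : Fin 6 → ℕ) (ρ : DensityMatrix ((i : Fin 6) → Fin (d i))),
      ρ.entropyVec = SixParty.ray) ∧
    SixParty.hypergraph.entropyVec = SixParty.ray ∧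
    ¬ RealizedByGraphModel SixParty.ray :=
  ⟨SixParty.generatesExtremeRay_ray, ⟨_, _, SixParty.entropyVec_state⟩,
    SixParty.entropyVec_hypergraph, SixParty.not_realizedByGraphModel_ray⟩
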